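/- A Steiner triple system STS$(n)$ is a set $V$ of $n$ points together with a family of 3-element subsets of $V$ (blocks) such that every two distinct points lie in exactly one block. Given a colouring of the blocks, a monochromatic connected component is a connected component of the hypergraph formed by $V$ and all blocks of one colour: two points $v,w$ are in the same component if there is a sequence $v=v_1,e_1,v_2,\dots,e_{t-1},v_t=w$ with $e_i$ a block of that colour and $v_i,v_{i+1}\in e_i$ for all $1\le i<t$ (a point on no block of that colour is a one-point component). For $n$ such that an STS$(n)$ exists, let $f(n)$ be the largest $m$ such that in every 3-colouring of the blocks of every STS$(n)$ there is a monochromatic connected component with at least $m$ points. Theorem. For every integer $k\ge 0$, $f(6k+3)\ge 4k+3$, with equality if $3$ divides $k$. Moreover, $f(6k+1)\ge 4k+2$ for every integer $k\ge 1$. -/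

import Mathlib

/-- A Steiner triple system on the finite point set `V`: a family of 3-element blocks such that
every two distinct points lie together in exactly one block. -/
structure SteinerTripleSystem (V : Type) where
  /-- the blocks of the system -/
  blocks : Finset (Finset V)
  card_block : ∀ B ∈ blocks, B.card = 3
  existsUnique_block : ∀ x y : V, x ≠ y → ∃! B, B ∈ blocks ∧ x ∈ B ∧ y ∈ B

/-- In the hypergraph with vertex set `V` and edge set `E`, the vertices `v` and `w` are joined by
a hyperwalk `v = v₁, e₁, v₂, e₂, …, e_{t-1}, v_t = w` with `v_i, v_{i+1} ∈ e_i ∈ E`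
(`t = 1` is allowed). -/
def HyperwalkJoined {V : Type} (E : Set (Finset V)) (v w : V) : Prop :=
  Relation.ReflTransGen (fun x y => ∃ e ∈ E, x ∈ e ∧ y ∈ e) v w

/-- `C` is the vertex set of a connected component of the hypergraph `(V, E)`: a class of the
equivalence relation "joined by a hyperwalk". An uncovered vertex is a one-point component. -/
def IsHypergraphComponent {V : Type} (E : Set (Finset V)) (C : Set V) : Prop :=
  ∃ v : V, C = {w | HyperwalkJoined E v w}

/-- The set of blocks that receive colour `i` in the 3-colouring `c` of the blocks. -/
def SteinerTripleSystem.colourClass {V : Type} (S : SteinerTripleSystem V)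
    (c : {B : Finset V // B ∈ S.blocks} → Fin 3) (i : Fin 3) : Set (Finset V) :=
  {B | ∃ h : B ∈ S.blocks, c ⟨B, h⟩ = i}

/-- In every 3-colouring of the blocks of every Steiner triple system on `n` points there is a
monochromatic connected component with at least `m` points. -/
def ForcesMonoComponent (n m : ℕ) : Prop :=
  ∀ (V : Type) [Fintype V], Fintype.card V = n →
    ∀ (S : SteinerTripleSystem V) (c : {B : Finset V // B ∈ S.blocks} → Fin 3),
      ∃ (i : Fin 3) (C : Set V), IsHypergraphComponent (S.colourClass c i) C ∧ m ≤ C.ncard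

/-- `monoComponentNumber n` is the largest `m` with `ForcesMonoComponent n m`. It is a natural
number whenever a Steiner triple system on `n` points exists; it is taken in `ℕ∞` so that no
finite junk value occurs for the other `n` (for them the condition on `m` is void and the
supremum is `⊤`). -/
noncomputable def monoComponentNumber (n : ℕ) : ℕ∞ :=
  sSup ((fun m : ℕ => (m : ℕ∞)) '' {m : ℕ | ForcesMonoComponent n m})

/-!
The lower bound rests on a count of signs. Suppose that every monochromatic component has at most
`M` points, with `3 M + 1 ≥ 2 n`. For each colour the components can be grouped into two sides of
at most `M` points each (`exists_balanced_cut`); let `f i` be the sign function of this cut for the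
colour `i`, so that `|∑ x, f i x| ≤ 2 M - n`. On a block of colour `i` the function `f i` is
constant, so the products `f i x * f i y` over its ordered pairs `x ≠ y` sum to `6`, while each of
the two other functions contributes at least `-2`. Every block thus contributes at least `2`, and as
the blocks partition the `n (n - 1)` ordered pairs, `∑ i, (∑ x, f i x) ^ 2 ≥ (n ^ 2 + 8 n) / 3`
(`SteinerTripleSystem.le_sum_sq_sum_sign`). This contradicts `|∑ x, f i x| ≤ 2 M - n` for
`n = 6 k + 3`, `M = 4 k + 2` and for `n = 6 k + 1`, `M = 4 k + 1`, `k ≥ 1`.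

For equality at `n = 18 j + 3` it suffices to find a system on three levels of `6 j` points and
three further points in which no block meets all three levels: colouring each block by a level that
it avoids, every component of colour `l` is a point of level `l` or lies in the complement of that
level, which has `12 j + 3` points (`SteinerTripleSystem.le_of_forcesMonoComponent`). Blocks
`{(x, i), (y, i), (x ∘ y, i + 1)}` from a commutative Latin square never meet three levels. The
square used is an addition table of `ZMod (6 j)` with relabelled entries. The pairs
`(x, i), (x ∘ x, i + 1)` are left over by it; together with the pairs of `3 j` further deleted
triples they form a cubic graph on the `18 j` points. A colouring of the elements makes this graph
the union of three perfect matchings, one for each of the three further points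
(`ColouredLatinSquare.matching`, `adjoinThree_inv`).
-/

/-! ### Hyperwalks and components -/

theorem HyperwalkJoined.symm {V : Type} {E : Set (Finset V)} {v w : V}
    (h : HyperwalkJoined E v w) : HyperwalkJoined E w v := by
  have : Std.Symm (fun x y : V => ∃ e ∈ E, x ∈ e ∧ y ∈ e) :=
    ⟨fun x y ⟨e, he, hx, hy⟩ => ⟨e, he, hy, hx⟩⟩
  exact Relation.ReflTransGen.stdSymm.symm _ _ h

/-- The equivalence relation whose classes are the components of the hypergraph `(V, E)`. -/
def hyperwalkSetoid {V : Type} (E : Set (Finset V)) : Setoid V where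
  r := HyperwalkJoined E
  iseqv := ⟨fun _ => Relation.ReflTransGen.refl, HyperwalkJoined.symm,
    Relation.ReflTransGen.trans⟩

/-! ### Balanced cuts along an equivalence relation -/

/-- If every class of an equivalence relation on an `n`-set has at most `M` elements and
`2 n ≤ 3 M + 1`, then the classes can be grouped into two sides of at most `M` elements each. -/
theorem exists_balanced_cut {V : Type} [Fintype V] (r : Setoid V) (n M : ℕ)
    (hn : Fintype.card V = n) (hM : 2 * n ≤ 3 * M + 1)
    (hcl : ∀ v : V, {w | r v w}.ncard ≤ M) :
    ∃ X : Finset V, (∀ x y, r x y → (x ∈ X ↔ y ∈ X)) ∧ X.card ≤ M ∧ n ≤ X.card + M := by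
  classical
  -- Among the unions of classes with at most `M` elements, take a largest one.
  let F : Finset (Finset V) :=
    Finset.univ.filter fun X => (∀ x y, r x y → (x ∈ X ↔ y ∈ X)) ∧ X.card ≤ M
  have hF : F.Nonempty := ⟨∅, by simp [F]⟩
  obtain ⟨X, hXF, hmax⟩ := F.exists_max_image Finset.card hF
  obtain ⟨hX, hXM⟩ : (∀ x y, r x y → (x ∈ X ↔ y ∈ X)) ∧ X.card ≤ M := by simpa [F] using hXF
  by_cases hbig : n ≤ X.card + M
  · exact ⟨X, hX, hXM, hbig⟩
  -- Otherwise any class outside it is so large that it can serve as one side on its own.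
  obtain ⟨v, hv⟩ : ∃ v, v ∉ X := by
    by_contra! h
    have : X.card = n := by
      rw [← hn, ← Finset.card_univ]; congr 1; ext v; simp [h v]
    omega
  let C : Finset V := Finset.univ.filter fun w => r v w
  have hC : ∀ x y, r x y → (x ∈ C ↔ y ∈ C) := by
    intro x y hxy
    simp only [C, Finset.mem_filter, Finset.mem_univ, true_and]
    exact ⟨fun h => r.trans h hxy, fun h => r.trans h (r.symm hxy)⟩
  have hCM : C.card ≤ M := by
    have := hcl v
    rwa [show {w | r v w} = (C : Set V) by ext; simp [C], Set.ncard_coe_finset] at this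
  have hvC : v ∈ C := by simp [C]
  have hdisj : Disjoint X C := by
    rw [Finset.disjoint_left]
    intro x hx hxC
    have : r v x := by simpa [C] using hxC
    exact hv ((hX v x this).2 hx)
  have hcard := Finset.card_union_of_disjoint hdisj
  have hpos : 0 < C.card := Finset.card_pos.2 ⟨v, hvC⟩
  have hlarge : M < X.card + C.card := by
    by_contra! h
    have hU : X ∪ C ∈ F := by
      simp only [F, Finset.mem_filter, Finset.mem_univ, true_and, Finset.mem_union]
      exact ⟨fun x y hxy => by rw [hX x y hxy, hC x y hxy], by omega⟩
    have := hmax _ hU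
    omega
  exact ⟨C, hC, hCM, by omega⟩

/-- The indicator of a balanced cut as a sign function: it is constant on the classes, and its
sum has absolute value at most `2 M - n`. -/
theorem exists_balanced_sign {V : Type} [Fintype V] (r : Setoid V) (n M : ℕ)
    (hn : Fintype.card V = n) (hM : 2 * n ≤ 3 * M + 1)
    (hcl : ∀ v : V, {w | r v w}.ncard ≤ M) :
    ∃ f : V → ℤ, (∀ x, f x = 1 ∨ f x = -1) ∧ (∀ x y, r x y → f x = f y) ∧
      |∑ x, f x| ≤ 2 * M - n := by
  classical
  obtain ⟨X, hX, h1, h2⟩ := exists_balanced_cut r n M hn hM hcl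
  refine ⟨fun x => if x ∈ X then 1 else -1, fun x => ?_, fun x y hxy => ?_, ?_⟩
  · dsimp only; split_ifs <;> simp
  · simp only [hX x y hxy]
  · have hs : ∑ x, (if x ∈ X then (1 : ℤ) else -1) = 2 * X.card - n := by
      have : ∀ x, (if x ∈ X then (1 : ℤ) else -1) = 2 * (if x ∈ X then 1 else 0) - 1 := by
        intro x; split_ifs <;> norm_num
      simp only [this, Finset.sum_sub_distrib, ← Finset.mul_sum]
      simp [hn]
    rw [hs, abs_le]
    constructor <;> omega

/-! ### Counting over pairs of points -/

/-- A sum over ordered pairs of distinct points is the sum of its restrictions to the blocks. -/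
theorem SteinerTripleSystem.sum_blocks_offDiag {V : Type} [Fintype V] [DecidableEq V]
    (S : SteinerTripleSystem V) (F : V × V → ℤ) :
    ∑ B ∈ S.blocks, ∑ p ∈ B.offDiag, F p = ∑ p ∈ (Finset.univ : Finset V).offDiag, F p := by
  have hU : (Finset.univ : Finset V).offDiag = S.blocks.biUnion Finset.offDiag := by
    ext ⟨x, y⟩
    simp only [Finset.mem_offDiag, Finset.mem_univ, true_and, Finset.mem_biUnion]
    constructor
    · intro h
      obtain ⟨B, ⟨hB, hx, hy⟩, -⟩ := S.existsUnique_block x y h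
      exact ⟨B, hB, hx, hy, h⟩
    · rintro ⟨B, -, -, -, h⟩
      exact h
  rw [hU, Finset.sum_biUnion]
  intro B hB B' hB' hne
  rw [Function.onFun, Finset.disjoint_left]
  rintro ⟨x, y⟩ h h'
  rw [Finset.mem_offDiag] at h h'
  exact hne ((S.existsUnique_block x y h.2.2).unique ⟨hB, h.1, h.2.1⟩ ⟨hB', h'.1, h'.2.1⟩)

theorem sum_offDiag_mul {V : Type} [DecidableEq V] (s : Finset V) (f : V → ℤ)
    (hf : ∀ x, f x = 1 ∨ f x = -1) :
    ∑ p ∈ s.offDiag, f p.1 * f p.2 = (∑ x ∈ s, f x) ^ 2 - s.card := by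
  have hd : ∑ p ∈ s.diag, f p.1 * f p.2 = s.card := by
    rw [Finset.sum_diag, Finset.sum_congr rfl (g := fun _ => (1 : ℤ))]
    · simp
    · intro x _
      rcases hf x with h | h <;> simp [h]
  have hall : ∑ p ∈ s ×ˢ s, f p.1 * f p.2 = (∑ x ∈ s, f x) ^ 2 := by
    rw [Finset.sum_product, sq, Finset.sum_mul_sum]
  rw [← Finset.diag_union_offDiag, Finset.sum_union (Finset.disjoint_diag_offDiag s), hd] at hall
  linarith

/-- If the sign function `f i` is constant on all blocks of colour `i`, for each of the three
colours, then the sums of the three functions cannot all be small. On a block of colour `i` the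
products `f i x * f i y` over ordered pairs `x ≠ y` add up to `6`, and those of the two other
functions to at least `-2` each, so that every block contributes at least `2` in total. -/
theorem SteinerTripleSystem.le_sum_sq_sum_sign {V : Type} [Fintype V]
    (S : SteinerTripleSystem V) (c : {B : Finset V // B ∈ S.blocks} → Fin 3)
    (f : Fin 3 → V → ℤ) (hf : ∀ i x, f i x = 1 ∨ f i x = -1)
    (hc : ∀ i, ∀ B ∈ S.colourClass c i, ∀ x ∈ B, ∀ y ∈ B, f i x = f i y) :
    (Fintype.card V : ℤ) ^ 2 + 8 * Fintype.card V ≤ 3 * ∑ i, (∑ x, f i x) ^ 2 := by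
  classical
  have hpair : ∀ s : Finset V,
      ∑ p ∈ s.offDiag, (3 * (∑ i, f i p.1 * f i p.2) - 1)
        = 3 * (∑ i, (∑ x ∈ s, f i x) ^ 2) - 9 * s.card - ((s.card : ℤ) ^ 2 - s.card) := by
    intro s
    rw [Finset.sum_sub_distrib, ← Finset.mul_sum, Finset.sum_comm]
    simp only [fun i => sum_offDiag_mul s (f i) (hf i), Finset.sum_sub_distrib]
    simp [Finset.offDiag_card, Nat.cast_sub (Nat.le_mul_self _)]
    ring
  have hB : ∀ B ∈ S.blocks, 0 ≤ ∑ p ∈ B.offDiag, (3 * (∑ i, f i p.1 * f i p.2) - 1) := by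
    intro B hB
    rw [hpair, S.card_block B hB]
    have hconst := hc (c ⟨B, hB⟩) B ⟨hB, rfl⟩
    obtain ⟨x, y, z, hxy, hxz, hyz, rfl⟩ := Finset.card_eq_three.1 (S.card_block B hB)
    have hsum : ∀ i, ∑ w ∈ {x, y, z}, f i w = f i x + f i y + f i z := by
      intro i
      rw [Finset.sum_insert (by simp [hxy, hxz]), Finset.sum_pair hyz]; ring
    simp only [hsum]
    -- A sum of three signs is odd, so its square is at least `1`.
    have h1 : ∀ i, 1 ≤ (f i x + f i y + f i z) ^ 2 := by
      intro i
      rcases hf i x with h | h <;> rcases hf i y with h' | h' <;> rcases hf i z with h'' | h'' <;>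
        rw [h, h', h''] <;> norm_num
    have h9 : (f (c ⟨_, hB⟩) x + f (c ⟨_, hB⟩) y + f (c ⟨_, hB⟩) z) ^ 2 = 9 := by
      rw [← hconst x (by simp) y (by simp), ← hconst x (by simp) z (by simp)]
      rcases hf (c ⟨_, hB⟩) x with h | h <;> rw [h] <;> norm_num
    generalize c ⟨_, hB⟩ = i at h9
    have := h1 0
    have := h1 1
    have := h1 2
    rw [Fin.sum_univ_three]
    fin_cases i <;> simp only [Fin.zero_eta, Fin.mk_one, Fin.reduceFinMk] at h9 <;> push_cast <;>
      linarith
  have htot := Finset.sum_nonneg hB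
  rw [S.sum_blocks_offDiag, hpair, Finset.card_univ] at htot
  linarith

/-! ### The lower bound -/

theorem forcesMonoComponent_succ {n M : ℕ} (hM : 2 * n ≤ 3 * M + 1)
    (hnum : 9 * (2 * (M : ℤ) - n) ^ 2 < (n : ℤ) ^ 2 + 8 * n) : ForcesMonoComponent n (M + 1) := by
  intro V _ hn S c
  by_contra! hno
  have hcl : ∀ i v, {w | (hyperwalkSetoid (S.colourClass c i)) v w}.ncard ≤ M := fun i v =>
    Nat.lt_succ_iff.1 (hno i _ ⟨v, rfl⟩)
  choose f hf hconst hsum using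
    fun i => exists_balanced_sign (hyperwalkSetoid (S.colourClass c i)) n M hn hM (hcl i)
  have hmain := S.le_sum_sq_sum_sign c f hf fun i B hB x hx y hy =>
    hconst i x y (Relation.ReflTransGen.single ⟨B, hB, hx, hy⟩)
  have hsq : ∀ i, (∑ x, f i x) ^ 2 ≤ (2 * (M : ℤ) - n) ^ 2 := fun i =>
    sq_le_sq' (abs_le.1 (hsum i)).1 (abs_le.1 (hsum i)).2
  rw [hn, Fin.sum_univ_three] at hmain
  linarith [hsq 0, hsq 1, hsq 2]

theorem forcesMonoComponent_three_mod_six (k : ℕ) : ForcesMonoComponent (6 * k + 3) (4 * k + 3) := by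
  refine forcesMonoComponent_succ (M := 4 * k + 2) (by omega) ?_
  push_cast
  nlinarith [Int.natCast_nonneg k]

theorem forcesMonoComponent_one_mod_six {k : ℕ} (hk : 1 ≤ k) :
    ForcesMonoComponent (6 * k + 1) (4 * k + 2) := by
  refine forcesMonoComponent_succ (M := 4 * k + 1) (by omega) ?_
  push_cast
  have : (1 : ℤ) ≤ k := by exact_mod_cast hk
  nlinarith

/-! ### Steiner triple systems from totally symmetric operations -/

/-- The Steiner triple system of a Steiner quasigroup: for an idempotent commutative operation
with `t x (t x y) = y`, the blocks are the sets `{x, y, t x y}` with `x ≠ y`. -/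
def SteinerTripleSystem.ofQuasigroup {V : Type} [Fintype V] [DecidableEq V] (t : V → V → V)
    (hidem : ∀ x, t x x = x) (hcomm : ∀ x y, t x y = t y x) (hinv : ∀ x y, t x (t x y) = y) :
    SteinerTripleSystem V where
  blocks := (Finset.univ : Finset V).offDiag.image fun p => {p.1, p.2, t p.1 p.2}
  card_block := by
    intro B hB
    obtain ⟨⟨x, y⟩, hp, rfl⟩ := Finset.mem_image.1 hB
    have hxy : x ≠ y := (Finset.mem_offDiag.1 hp).2.2
    have h1 : ∀ x y, x ≠ y → x ≠ t x y := fun x y hxy h => hxy <| by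
      have := hinv x y
      rwa [← h, hidem] at this
    have h2 : y ≠ t x y := hcomm x y ▸ h1 y x hxy.symm
    exact Finset.card_eq_three.2 ⟨x, y, t x y, hxy, h1 x y hxy, h2, rfl⟩
  existsUnique_block := by
    intro x y hxy
    refine ⟨{x, y, t x y}, ⟨?_, by simp, by simp⟩, ?_⟩
    · exact Finset.mem_image.2 ⟨(x, y), by simp [hxy], rfl⟩
    · rintro B ⟨hB, hx, hy⟩
      obtain ⟨⟨a, b⟩, -, rfl⟩ := Finset.mem_image.1 hB
      simp only [Finset.mem_insert, Finset.mem_singleton] at hx hy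
      have h1 : t a (t a b) = b := hinv a b
      have h2 : t b (t a b) = a := by rw [hcomm a b]; exact hinv b a
      have h3 : t (t a b) a = b := by rw [hcomm, h1]
      have h4 : t (t a b) b = a := by rw [hcomm, h2]
      have h5 : t b a = t a b := hcomm b a
      rcases hx with rfl | rfl | rfl <;> rcases hy with rfl | rfl | rfl <;>
        first
        | exact absurd rfl hxy
        | simp only [h1, h2, h3, h4, h5] <;> ext z <;>
            simp only [Finset.mem_insert, Finset.mem_singleton] <;> tauto

/-- If some points carry one of three labels, and every block avoids one of the labels, then
colouring each block by a label that it avoids keeps every monochromatic component inside the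
complement of one label class, or makes it a single point. -/
theorem SteinerTripleSystem.le_of_forcesMonoComponent {V : Type} [Fintype V]
    (S : SteinerTripleSystem V) (label : V → Option (Fin 3))
    (hS : ∀ B ∈ S.blocks, ∃ l, ∀ x ∈ B, label x ≠ some l) {m : ℕ} (hm : 1 ≤ m)
    (hcard : ∀ l, {v | label v ≠ some l}.ncard ≤ m) {m' : ℕ}
    (h : ForcesMonoComponent (Fintype.card V) m') : m' ≤ m := by
  choose c hc using fun B : {B : Finset V // B ∈ S.blocks} => hS B.1 B.2
  obtain ⟨l, C, ⟨v, rfl⟩, hC⟩ := h V rfl S c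
  refine hC.trans ?_
  have hstep : ∀ x y, (∃ e ∈ S.colourClass c l, x ∈ e ∧ y ∈ e) →
      label x ≠ some l ∧ label y ≠ some l := by
    rintro x y ⟨e, ⟨he, rfl⟩, hx, hy⟩
    exact ⟨hc ⟨e, he⟩ x hx, hc ⟨e, he⟩ y hy⟩
  by_cases hv : label v = some l
  · refine le_trans (b := ({v} : Set V).ncard) (Set.ncard_le_ncard ?_ (Set.toFinite _))
      (by simpa using hm)
    intro w hw
    rcases Relation.ReflTransGen.cases_head hw with h | ⟨x, hx, -⟩
    · exact h.symm
    · exact absurd hv (hstep _ _ hx).1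
  · refine le_trans (Set.ncard_le_ncard ?_ (Set.toFinite _)) (hcard l)
    intro w hw
    rcases Relation.ReflTransGen.cases_tail hw with h | ⟨x, -, hx⟩
    · rw [Set.mem_ofPred_eq, h]; exact hv
    · exact (hstep _ _ hx).2

/-! ### Adjoining three points to a totally symmetric quasigroup -/

section Extension

variable {W : Type} [DecidableEq W]

open Classical in
/-- Given an operation `q` on `W` and three maps `m c : W → W`, to be thought of as perfect
matchings of `W`, the operation on `W` together with three new points in which the new point `c`
and `u` have the third point `m c u`, and in which `q` governs the pairs that no matching joins. -/
noncomputable def adjoinThree (q : W → W → W) (m : Fin 3 → W → W) :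
    Fin 3 ⊕ W → Fin 3 ⊕ W → Fin 3 ⊕ W
  | .inl a, .inl b => .inl (-(a + b))
  | .inl a, .inr u => .inr (m a u)
  | .inr u, .inl a => .inr (m a u)
  | .inr u, .inr v =>
    if u = v then .inr u else if h : ∃ c, m c u = v then .inl h.choose else .inr (q u v)

variable {q : W → W → W} {m : Fin 3 → W → W}

theorem adjoinThree_self (x : Fin 3 ⊕ W) : adjoinThree q m x x = x := by
  rcases x with a | u
  · simp only [adjoinThree]
    congr 1
    revert a; decide
  · simp [adjoinThree]

theorem adjoinThree_matched (hm : ∀ c u, m c u ≠ u) (hd : ∀ c d u, m c u = m d u → c = d)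
    (c : Fin 3) (u : W) : adjoinThree q m (.inr u) (.inr (m c u)) = .inl c := by
  have h : ∃ d, m d u = m c u := ⟨c, rfl⟩
  simp only [adjoinThree, if_neg (hm c u).symm, dif_pos h]
  exact congrArg _ (hd _ _ _ h.choose_spec)

theorem adjoinThree_unmatched {u v : W} (huv : u ≠ v) (h : ¬∃ c, m c u = v) :
    adjoinThree q m (.inr u) (.inr v) = .inr (q u v) := by
  simp only [adjoinThree, if_neg huv, dif_neg h]

theorem adjoinThree_comm (hq : ∀ u v, q u v = q v u) (hinv : ∀ c u, m c (m c u) = u)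
    (hm : ∀ c u, m c u ≠ u) (hd : ∀ c d u, m c u = m d u → c = d) (x y : Fin 3 ⊕ W) :
    adjoinThree q m x y = adjoinThree q m y x := by
  rcases x with a | u <;> rcases y with b | v
  · simp only [adjoinThree, add_comm]
  · rfl
  · rfl
  · by_cases huv : u = v
    · rw [huv]
    by_cases h : ∃ c, m c u = v
    · obtain ⟨c, rfl⟩ := h
      rw [adjoinThree_matched hm hd]
      nth_rewrite 2 [← hinv c u]
      rw [adjoinThree_matched hm hd]
    · have h' : ¬∃ c, m c v = u := fun ⟨c, hc⟩ => h ⟨c, by rw [← hc, hinv]⟩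
      rw [adjoinThree_unmatched huv h, adjoinThree_unmatched (Ne.symm huv) h', hq]

/-- The extended operation is a Steiner quasigroup if the matchings are disjoint, cover every
degenerate pair `u, q u u`, and together contain with a pair `u, v` also the pair `u, q u v`:
these are the pairs of a set of triples `{u, v, q u v}` removed from `q`. -/
theorem adjoinThree_inv (hq : ∀ u v, q u v = q v u) (hqinv : ∀ u v, q u (q u v) = v)
    (hinv : ∀ c u, m c (m c u) = u) (hm : ∀ c u, m c u ≠ u)
    (hd : ∀ c d u, m c u = m d u → c = d) (hdeg : ∀ u, ∃ c, m c u = q u u)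
    (htri : ∀ c u, q u (m c u) = u ∨ q u (m c u) = m c u ∨ ∃ d, m d u = q u (m c u))
    (x y : Fin 3 ⊕ W) : adjoinThree q m x (adjoinThree q m x y) = y := by
  rcases x with a | u <;> rcases y with b | v
  · simp only [adjoinThree]
    congr 1
    revert a b; decide
  · simp only [adjoinThree, hinv]
  · exact adjoinThree_matched hm hd b u
  · by_cases huv : u = v
    · rw [huv, adjoinThree_self, adjoinThree_self]
    by_cases h : ∃ c, m c u = v
    · obtain ⟨c, rfl⟩ := h
      rw [adjoinThree_matched hm hd]
      rfl
    rw [adjoinThree_unmatched huv h, adjoinThree_unmatched, hqinv]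
    · intro he
      obtain ⟨c, hc⟩ := hdeg u
      have := hqinv u v
      rw [← he] at this
      exact h ⟨c, hc.trans this⟩
    · rintro ⟨c, hc⟩
      have key := htri c u
      rw [hc, hqinv] at key
      rcases key with h1 | h1 | h1
      · exact huv h1.symm
      · obtain ⟨d, hdv⟩ := hdeg v
        have : q v v = u := by
          have := hqinv v u
          rwa [hq v u, ← h1] at this
        exact h ⟨d, by rw [← hinv d v, hdv, this] ⟩
      · exact h h1

end Extension

/-! ### Three cyclically linked copies of a coloured Latin square -/

/-- A commutative Latin square `x ∘ y = χ⁻¹ (φ x + φ y)` on `Fin 3 × T × Bool`, where the first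
coordinate is a colour and the last one tells the squares `x ∘ x` (`true`) from the nonsquares.
Every square `(b, t)` has one square root of each of the colours different from `b`, and
`(0, t) ∘ (1, t) = (2, t)` on nonsquares. -/
structure ColouredLatinSquare (T A : Type) [AddCommGroup A] where
  /-- the bijection that turns elements, as arguments of `∘`, into elements of `A` -/
  φ : Fin 3 × T × Bool ≃ A
  /-- the bijection that turns elements, as values of `∘`, into elements of `A` -/
  χ : Fin 3 × T × Bool ≃ A
  /-- the square of an element -/
  sq : Fin 3 × T × Bool → Fin 3 × T
  /-- `root b t c` is the square root of colour `c` of the square `(b, t)`, for `c ≠ b` -/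
  root : Fin 3 → T → Fin 3 → Fin 3 × T × Bool
  φ_add_self : ∀ x, φ x + φ x = χ ((sq x).1, (sq x).2, true)
  sq_fst_ne : ∀ x, (sq x).1 ≠ x.1
  root_fst : ∀ b t c, c ≠ b → (root b t c).1 = c
  sq_root : ∀ b t c, c ≠ b → sq (root b t c) = (b, t)
  sq_inj : ∀ x y, x.1 = y.1 → sq x = sq y → x = y
  φ_add_φ : ∀ t, φ (0, t, false) + φ (1, t, false) = χ (2, t, false)

namespace ColouredLatinSquare

variable {T A : Type} [AddCommGroup A] (L : ColouredLatinSquare T A)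

/-- The totally symmetric quasigroup on three levels, indexed by `Fin 3`, in which the third point
of `(x, i)` and `(y, i)` is `(x ∘ y, i + 1)`. -/
def levelOp (u v : (Fin 3 × T × Bool) × Fin 3) : (Fin 3 × T × Bool) × Fin 3 :=
  if v.2 = u.2 then (L.χ.symm (L.φ u.1 + L.φ v.1), u.2 + 1)
  else if v.2 = u.2 + 1 then (L.φ.symm (L.χ v.1 - L.φ u.1), u.2)
  else (L.φ.symm (L.χ u.1 - L.φ v.1), v.2)

theorem levelOp_same (x y : Fin 3 × T × Bool) (i : Fin 3) :
    L.levelOp (x, i) (y, i) = (L.χ.symm (L.φ x + L.φ y), i + 1) := by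
  simp [levelOp]

theorem levelOp_up (x y : Fin 3 × T × Bool) (i : Fin 3) :
    L.levelOp (x, i) (y, i + 1) = (L.φ.symm (L.χ y - L.φ x), i) := by
  have h : i + 1 ≠ i := by revert i; decide
  simp [levelOp]

theorem levelOp_down (x y : Fin 3 × T × Bool) (i : Fin 3) :
    L.levelOp (x, i + 1) (y, i) = (L.φ.symm (L.χ x - L.φ y), i) := by
  have h : i ≠ i + 1 := by revert i; decide
  have h' : i ≠ i + 1 + 1 := by revert i; decide
  simp only [levelOp, if_neg h, if_neg h']

theorem level_cases (i k : Fin 3) : k = i ∨ k = i + 1 ∨ i = k + 1 := by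
  revert i k; decide

theorem levelOp_comm (u v : (Fin 3 × T × Bool) × Fin 3) : L.levelOp u v = L.levelOp v u := by
  obtain ⟨x, i⟩ := u
  obtain ⟨y, k⟩ := v
  rcases level_cases i k with rfl | rfl | rfl
  · rw [levelOp_same, levelOp_same, add_comm]
  · rw [levelOp_up, levelOp_down]
  · rw [levelOp_up, levelOp_down]

theorem levelOp_inv (u v : (Fin 3 × T × Bool) × Fin 3) : L.levelOp u (L.levelOp u v) = v := by
  obtain ⟨x, i⟩ := u
  obtain ⟨y, k⟩ := v
  rcases level_cases i k with rfl | rfl | rfl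
  · simp [levelOp_same, levelOp_up]
  · simp [levelOp_same, levelOp_up]
  · simp [levelOp_down]

theorem exists_level_avoided (u v : (Fin 3 × T × Bool) × Fin 3) :
    ∃ l, u.2 ≠ l ∧ v.2 ≠ l ∧ (L.levelOp u v).2 ≠ l := by
  obtain ⟨x, i⟩ := u
  obtain ⟨y, k⟩ := v
  have h : ∀ i : Fin 3, i ≠ i + 2 ∧ i + 1 ≠ i + 2 := by decide
  rcases level_cases i k with rfl | rfl | rfl
  · exact ⟨k + 2, (h k).1, (h k).1, by rw [levelOp_same]; exact (h k).2⟩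
  · exact ⟨i + 2, (h i).1, (h i).2, by rw [levelOp_up]; exact (h i).1⟩
  · exact ⟨k + 2, (h k).2, (h k).1, by rw [levelOp_down]; exact (h k).1⟩

/-- The level, relative to the triple, of the nonsquare of colour `b` in the triples
`{((0, t), i), ((1, t), i), ((2, t), i + 1)}`. -/
def shift (b : Fin 3) : Fin 3 := if b = 2 then 1 else 0

/-- The three matchings. The degenerate pair of `(x, i)` and `(x ∘ x, i + 1)` belongs to the
colour of `x`; a pair inside a triple `{((0, t), i), ((1, t), i), ((2, t), i + 1)}` of nonsquares
belongs to the colour of the third point. Thus a square is matched to its own square and to its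
two roots, and a nonsquare to its square and to the two other points of its triple. -/
def matching (c : Fin 3) : (Fin 3 × T × Bool) × Fin 3 → (Fin 3 × T × Bool) × Fin 3
  | ((b, t, p), i) =>
    if b = c then (((L.sq (b, t, p)).1, (L.sq (b, t, p)).2, true), i + 1)
    else match p with
      | true => (L.root b t c, i - 1)
      | false => ((-(b + c), t, false), i + shift (-(b + c)) - shift b)

theorem matching_own (x : Fin 3 × T × Bool) (i : Fin 3) :
    L.matching x.1 (x, i) = (((L.sq x).1, (L.sq x).2, true), i + 1) := by
  obtain ⟨b, t, p⟩ := x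
  simp [matching]

theorem matching_square {b c : Fin 3} (h : b ≠ c) (t : T) (i : Fin 3) :
    L.matching c ((b, t, true), i) = (L.root b t c, i - 1) := by
  simp [matching, h]

theorem matching_nonsquare {b c : Fin 3} (h : b ≠ c) (t : T) (i : Fin 3) :
    L.matching c ((b, t, false), i)
      = ((-(b + c), t, false), i + shift (-(b + c)) - shift b) := by
  simp [matching, h]

theorem root_sq {x : Fin 3 × T × Bool} : L.root (L.sq x).1 (L.sq x).2 x.1 = x :=
  L.sq_inj _ _ (L.root_fst _ _ _ (L.sq_fst_ne x).symm) (L.sq_root _ _ _ (L.sq_fst_ne x).symm)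

theorem matching_matching (c : Fin 3) (u : (Fin 3 × T × Bool) × Fin 3) :
    L.matching c (L.matching c u) = u := by
  obtain ⟨⟨b, t, p⟩, i⟩ := u
  by_cases hb : b = c
  · subst hb
    have h1 := L.matching_own (b, t, p) i
    have h2 := L.sq_fst_ne (b, t, p)
    have h3 := L.root_sq (x := (b, t, p))
    dsimp only at h1 h2 h3
    rw [h1, matching_square _ h2, h3, add_sub_cancel_right]
  · cases p
    · have h1 : -(b + c) ≠ c ∧ -(-(b + c) + c) = b := by revert b c; decide
      rw [matching_nonsquare _ hb, matching_nonsquare _ h1.1, h1.2]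
      congr 1
      abel
    · have h1 := L.root_fst b t c (Ne.symm hb)
      have h2 := L.matching_own (L.root b t c) (i - 1)
      rw [h1] at h2
      rw [matching_square _ hb, h2, L.sq_root b t c (Ne.symm hb), sub_add_cancel]

/-- Every matching moves the colour of a point: partners in the matching `c` are distinct. -/
theorem matching_ne (c : Fin 3) (u : (Fin 3 × T × Bool) × Fin 3) : L.matching c u ≠ u := by
  obtain ⟨⟨b, t, p⟩, i⟩ := u
  intro h
  by_cases hb : b = c
  · subst hb
    have h1 := L.matching_own (b, t, p) i
    dsimp only at h1
    rw [h1] at h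
    exact L.sq_fst_ne (b, t, p) (congrArg (fun z => z.1.1) h)
  · cases p
    · rw [matching_nonsquare _ hb] at h
      have h1 : -(b + c) = b := congrArg (fun z => z.1.1) h
      clear h
      revert b c; decide
    · rw [matching_square _ hb] at h
      have h1 : (L.root b t c).1 = b := congrArg (fun z => z.1.1) h
      rw [L.root_fst b t c (Ne.symm hb)] at h1
      exact hb h1.symm

theorem matching_injective_colour (c d : Fin 3) (u : (Fin 3 × T × Bool) × Fin 3)
    (h : L.matching c u = L.matching d u) : c = d := by
  obtain ⟨⟨b, t, p⟩, i⟩ := u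
  have hown := L.matching_own (b, t, p) i
  dsimp only at hown
  -- The square of a point lies one level up and is a square; no other partner is of this kind.
  have aux : ∀ e, b ≠ e → L.matching e ((b, t, p), i) ≠ L.matching b ((b, t, p), i) := by
    intro e he h
    rw [hown] at h
    cases p
    · rw [matching_nonsquare _ he] at h
      exact Bool.false_ne_true (congrArg (fun z => z.1.2.2) h)
    · rw [matching_square _ he] at h
      have h1 : i - 1 = i + 1 := congrArg (fun z => z.2) h
      have h2 : ∀ i : Fin 3, i - 1 ≠ i + 1 := by decide
      exact h2 i h1
  by_cases hc : b = c
  · subst hc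
    by_contra hd
    exact aux d hd h.symm
  by_cases hd : b = d
  · subst hd
    exact absurd h (aux c hc)
  cases p
  · rw [matching_nonsquare _ hc, matching_nonsquare _ hd] at h
    have h1 : -(b + c) = -(b + d) := congrArg (fun z => z.1.1) h
    exact add_left_cancel (neg_injective h1)
  · rw [matching_square _ hc, matching_square _ hd] at h
    have h1 : (L.root b t c).1 = (L.root b t d).1 := congrArg (fun z => z.1.1) h
    rwa [L.root_fst b t c (Ne.symm hc), L.root_fst b t d (Ne.symm hd)] at h1

theorem levelOp_self (x : Fin 3 × T × Bool) (i : Fin 3) :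
    L.levelOp (x, i) (x, i) = L.matching x.1 (x, i) := by
  rw [levelOp_same, matching_own, L.φ_add_self, Equiv.symm_apply_apply]

/-- The triples of nonsquares covered by the matchings are triples of `levelOp`. -/
theorem levelOp_nonsquare {b c : Fin 3} (h : b ≠ c) (t : T) (i : Fin 3) :
    L.levelOp ((b, t, false), i + shift b) ((c, t, false), i + shift c)
      = ((-(b + c), t, false), i + shift (-(b + c))) := by
  have h01 : L.levelOp ((0, t, false), i) ((1, t, false), i) = ((2, t, false), i + 1) := by
    rw [levelOp_same, L.φ_add_φ, Equiv.symm_apply_apply]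
  have h10 := h01
  rw [levelOp_comm] at h10
  have h02 : L.levelOp ((0, t, false), i) ((2, t, false), i + 1) = ((1, t, false), i) := by
    rw [← h01, levelOp_inv]
  have h12 : L.levelOp ((1, t, false), i) ((2, t, false), i + 1) = ((0, t, false), i) := by
    rw [← h10, levelOp_inv]
  have h20 := h02
  have h21 := h12
  rw [levelOp_comm] at h20 h21
  have hneg : (-1 : Fin 3) = 2 ∧ (-2 : Fin 3) = 1 := by decide
  fin_cases b <;> fin_cases c <;>
    first
    | exact absurd rfl h
    | simpa [shift, hneg.1, hneg.2] using h01
    | simpa [shift, hneg.1, hneg.2] using h10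
    | simpa [shift, hneg.1, hneg.2] using h02
    | simpa [shift, hneg.1, hneg.2] using h20
    | simpa [shift, hneg.1, hneg.2] using h12
    | simpa [shift, hneg.1, hneg.2] using h21

theorem levelOp_matching (c : Fin 3) (u : (Fin 3 × T × Bool) × Fin 3) :
    L.levelOp u (L.matching c u) = u ∨ L.levelOp u (L.matching c u) = L.matching c u ∨
      ∃ d, L.matching d u = L.levelOp u (L.matching c u) := by
  obtain ⟨⟨b, t, p⟩, i⟩ := u
  by_cases hb : b = c
  · subst hb
    have h := L.levelOp_self (b, t, p) i
    dsimp only at h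
    exact Or.inl (by rw [← h, levelOp_inv])
  · cases p
    · right; right
      have h1 : b ≠ -(b + c) ∧ -(b + -(b + c)) = c := by revert b c; decide
      refine ⟨-(b + c), ?_⟩
      have h2 := L.levelOp_nonsquare h1.1 t (i - shift b)
      rw [sub_add_cancel, h1.2, sub_add_eq_add_sub, sub_add_eq_add_sub] at h2
      rw [matching_nonsquare _ hb, matching_nonsquare _ h1.1, h2, h1.2]
    · right; left
      have h1 := L.matching_matching c ((b, t, true), i)
      have h2 := L.levelOp_self (L.root b t c) (i - 1)
      rw [L.root_fst b t c (Ne.symm hb), ← matching_square _ hb t i, h1] at h2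
      rw [levelOp_comm]
      nth_rewrite 2 [← h2]
      rw [levelOp_inv]

/-- A coloured Latin square of order `6 * j` yields a Steiner triple system on `18 * j + 3` points
with a `3`-colouring all of whose components have at most `12 * j + 3` points. -/
theorem le_of_forcesMonoComponent [Fintype T] (L : ColouredLatinSquare T A) {m : ℕ}
    (h : ForcesMonoComponent (18 * Fintype.card T + 3) m) : m ≤ 12 * Fintype.card T + 3 := by
  classical
  let op := adjoinThree L.levelOp L.matching
  let S := SteinerTripleSystem.ofQuasigroup op adjoinThree_self
    (adjoinThree_comm L.levelOp_comm L.matching_matching L.matching_ne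
      L.matching_injective_colour)
    (adjoinThree_inv L.levelOp_comm L.levelOp_inv L.matching_matching L.matching_ne
      L.matching_injective_colour (fun u => ⟨u.1.1, (L.levelOp_self u.1 u.2).symm⟩)
      L.levelOp_matching)
  let label : Fin 3 ⊕ ((Fin 3 × T × Bool) × Fin 3) → Option (Fin 3) :=
    Sum.elim (fun _ => none) fun u => some u.2
  have hV : Fintype.card (Fin 3 ⊕ ((Fin 3 × T × Bool) × Fin 3)) = 18 * Fintype.card T + 3 := by
    simp; ring
  have hlabel : ∀ x y, ∃ l, label x ≠ some l ∧ label y ≠ some l ∧ label (op x y) ≠ some l := by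
    have h2 : ∀ i k : Fin 3, ∃ l, i ≠ l ∧ k ≠ l := by decide
    rintro (a | u) (b | v)
    · exact ⟨0, by simp [label, op, adjoinThree]⟩
    · obtain ⟨l, hl⟩ := h2 v.2 (L.matching a v).2
      exact ⟨l, by simpa [label, op, adjoinThree] using hl⟩
    · obtain ⟨l, hl⟩ := h2 u.2 (L.matching b u).2
      exact ⟨l, by simpa [label, op, adjoinThree] using hl⟩
    · obtain ⟨l, hl⟩ := L.exists_level_avoided u v
      refine ⟨l, by simpa [label] using hl.1, by simpa [label] using hl.2.1, ?_⟩
      simp only [op, adjoinThree]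
      split_ifs
      · simpa [label] using hl.1
      · simp [label]
      · simpa [label] using hl.2.2
  refine S.le_of_forcesMonoComponent label ?_ (by omega) ?_ (hV ▸ h)
  · intro B hB
    obtain ⟨⟨x, y⟩, -, rfl⟩ := Finset.mem_image.1 hB
    obtain ⟨l, hl⟩ := hlabel x y
    refine ⟨l, fun z hz => ?_⟩
    simp only [Finset.mem_insert, Finset.mem_singleton] at hz
    rcases hz with rfl | rfl | rfl
    exacts [hl.1, hl.2.1, hl.2.2]
  · intro l
    -- The complement of the label class of `l`: the three new points and two of the levels.
    have hset : {v | label v ≠ some l} = ((Finset.univ : Finset (Fin 3)).disjSum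
        ((Finset.univ : Finset (Fin 3 × T × Bool)) ×ˢ ({l}ᶜ : Finset (Fin 3))) : Set _) := by
      ext v
      rcases v with a | u <;> simp [label]
    rw [hset, Set.ncard_coe_finset, Finset.card_disjSum, Finset.card_product, Finset.card_compl]
    simp
    omega

end ColouredLatinSquare

/-! ### A coloured Latin square in the cyclic group of order `6 * j` -/

namespace CyclicConstruction

variable {j : ℕ}

/-- The position in `[0, 2 * j)` of an element among those of its colour: for colours `0` and `2`
the nonsquares have the even positions, for colour `1` the odd ones. -/
def position : Fin 3 × Fin j × Bool → ℕ
  | (c, t, p) => 2 * t + if (p = true ↔ c = 1) then 0 else 1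

/-- The representative in `[0, 6 * j)` of an element as an argument of the Latin square. -/
def argument (x : Fin 3 × Fin j × Bool) : ℕ := 2 * j * x.1 + position x

/-- The representative in `[0, 6 * j)` of an element as a value of the Latin square. The even
numbers belong to squares, the odd ones to nonsquares. The choice for the nonsquares of colour `2`
is the sum of the arguments of the nonsquares `(0, t)` and `(1, t)`; the two other colours share
the remaining odd numbers. The square `(b, t)` has the value `2 * a` with `a = (2 - b) * j + t` in
`[0, 3 * j)`, and its roots are the elements with the arguments `a` and `a + 3 * j`, which have
the two colours different from `b`. -/
def value : Fin 3 × Fin j × Bool → ℕ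
  | (b, t, true) => 2 * ((2 - (b : ℕ)) * j + t)
  | (b, t, false) => if b = 0 then 2 * t + 1 else if b = 1 then 4 * t + 2 * j + 3
      else 4 * t + 2 * j + 1

theorem position_lt (x : Fin 3 × Fin j × Bool) : position x < 2 * j := by
  obtain ⟨c, t, p⟩ := x
  simp only [position]
  split_ifs <;> omega

theorem position_injective {x y : Fin 3 × Fin j × Bool} (h : x.1 = y.1)
    (h' : position x = position y) : x = y := by
  obtain ⟨c, t, p⟩ := x
  obtain ⟨d, s, r⟩ := y
  obtain rfl : c = d := h
  simp only [position] at h'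
  by_cases hc : c = 1 <;> cases p <;> cases r <;> simp [hc] at h' ⊢ <;> omega

theorem argument_injective : Function.Injective (argument (j := j)) := by
  intro x y h
  have hx := position_lt x
  have hy := position_lt y
  have h1 : x.1 = y.1 := by
    simp only [argument] at h
    generalize position x = s at *
    generalize position y = r at *
    generalize x.1 = c at *
    generalize y.1 = d at *
    fin_cases c <;> fin_cases d <;> simp at h ⊢ <;> omega
  refine position_injective h1 ?_
  simpa [argument, h1] using h

theorem argument_lt (x : Fin 3 × Fin j × Bool) : argument x < 6 * j := by
  have hx := position_lt x
  simp only [argument]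
  generalize position x = s at *
  generalize x.1 = c
  fin_cases c <;> simp <;> omega

theorem value_injective : Function.Injective (value (j := j)) := by
  rintro ⟨b, t, p⟩ ⟨d, s, r⟩ h
  fin_cases b <;> fin_cases d <;> cases p <;> cases r <;> simp [value] at h ⊢ <;> omega

theorem value_lt (x : Fin 3 × Fin j × Bool) : value x < 6 * j := by
  obtain ⟨b, t, p⟩ := x
  fin_cases b <;> cases p <;> simp [value] <;> omega

/-- An injective numbering by numbers below `6 * j` is a bijection to `ZMod (6 * j)`. -/
noncomputable def toZMod [NeZero j] (f : Fin 3 × Fin j × Bool → ℕ) (hf : Function.Injective f)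
    (hlt : ∀ x, f x < 6 * j) : Fin 3 × Fin j × Bool ≃ ZMod (6 * j) :=
  Equiv.ofBijective (fun x => (f x : ZMod (6 * j))) <| by
    rw [Fintype.bijective_iff_injective_and_card]
    refine ⟨fun x y h => hf ?_, ?_⟩
    · rwa [ZMod.natCast_eq_natCast_iff', Nat.mod_eq_of_lt (hlt x), Nat.mod_eq_of_lt (hlt y)] at h
    · rw [ZMod.card]; simp; ring

/-- The square of an element: the elements at the positions `t` and `t + j` of their colour have
squares with the index `t`. -/
def square (x : Fin 3 × Fin j × Bool) : Fin 3 × Fin j :=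
  if h : position x < j then (x.1 + 2, ⟨position x, h⟩)
  else (x.1 + 1, ⟨position x - j, by have := position_lt x; omega⟩)

theorem two_mul_argument (x : Fin 3 × Fin j × Bool) :
    2 * argument x = value ((square x).1, (square x).2, true) ∨
      2 * argument x = value ((square x).1, (square x).2, true) + 6 * j := by
  have hx := position_lt x
  unfold square argument
  split_ifs with h <;> simp only [value] <;> generalize position x = s at * <;>
    generalize x.1 = c <;> fin_cases c <;> simp <;> omega

theorem square_fst_ne (x : Fin 3 × Fin j × Bool) : (square x).1 ≠ x.1 := by
  have h : ∀ c : Fin 3, c + 2 ≠ c ∧ c + 1 ≠ c := by decide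
  unfold square
  split_ifs
  exacts [(h _).1, (h _).2]

theorem square_injective {x y : Fin 3 × Fin j × Bool} (h : x.1 = y.1)
    (h' : square x = square y) : x = y := by
  have hc : ∀ c : Fin 3, c + 2 ≠ c + 1 := by decide
  refine position_injective h ?_
  simp only [square, h] at h'
  split_ifs at h' <;> simp at h' <;> omega

theorem exists_root (b : Fin 3) (t : Fin j) (c : Fin 3) :
    ∃ x : Fin 3 × Fin j × Bool, c ≠ b → x.1 = c ∧ square x = (b, t) := by
  have hpos : ∀ s < 2 * j, ∃ x : Fin 3 × Fin j × Bool, x.1 = c ∧ position x = s := by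
    intro s hs
    refine ⟨(c, ⟨s / 2, by omega⟩, if s % 2 = 0 then decide (c = 1) else !decide (c = 1)), rfl, ?_⟩
    by_cases hc : c = 1 <;> by_cases h : s % 2 = 0 <;> simp [position, hc, h] <;> omega
  by_cases hb : b = c + 2
  · obtain ⟨x, hx, hs⟩ := hpos t (by omega)
    exact ⟨x, fun _ => ⟨hx, by simp [square, hs, hx, hb]⟩⟩
  · obtain ⟨x, hx, hs⟩ := hpos (t + j) (by omega)
    refine ⟨x, fun hne => ⟨hx, ?_⟩⟩
    have hb' : c + 1 = b := by clear hx hpos; revert b c; decide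
    simp [square, hs, hx, hb']

/-- The coloured Latin square of order `6 * j` over `ZMod (6 * j)`. -/
noncomputable def latinSquare (j : ℕ) [NeZero j] :
    ColouredLatinSquare (Fin j) (ZMod (6 * j)) where
  φ := toZMod argument argument_injective argument_lt
  χ := toZMod value value_injective value_lt
  sq := square
  root b t c := (exists_root b t c).choose
  φ_add_self x := by
    change (argument x : ZMod (6 * j)) + argument x = (value _ : ℕ)
    rw [← two_mul]
    have h0 : ((6 * j : ℕ) : ZMod (6 * j)) = 0 := ZMod.natCast_self _
    rcases two_mul_argument x with h | h
    · rw [← h]; push_cast; rfl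
    · have := congrArg (Nat.cast : ℕ → ZMod (6 * j)) h
      rw [Nat.cast_add, h0, add_zero] at this
      rw [← this]; push_cast; rfl
  sq_fst_ne := square_fst_ne
  root_fst b t c h := ((exists_root b t c).choose_spec h).1
  sq_root b t c h := ((exists_root b t c).choose_spec h).2
  sq_inj _ _ := square_injective
  φ_add_φ t := by
    change (argument _ : ZMod (6 * j)) + argument _ = (value _ : ℕ)
    rw [← Nat.cast_add]
    congr 1
    simp [argument, position, value]
    omega

end CyclicConstruction

/-! ### The values of `monoComponentNumber` -/

theorem le_of_forcesMonoComponent_three {m : ℕ} (h : ForcesMonoComponent 3 m) : m ≤ 3 := by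
  let S := SteinerTripleSystem.ofQuasigroup (fun x y : Fin 3 => -(x + y)) (by decide) (by decide)
    (by decide)
  refine S.le_of_forcesMonoComponent (fun _ => none) (fun _ _ => ⟨0, by simp⟩) (by omega)
    (fun l => ?_) h
  simp [Set.ncard_univ]

theorem le_of_forcesMonoComponent_eighteen_mul_add_three (j : ℕ) {m : ℕ}
    (h : ForcesMonoComponent (18 * j + 3) m) : m ≤ 12 * j + 3 := by
  -- `ZMod 0` is infinite, so the system on a single block is treated separately.
  rcases Nat.eq_zero_or_pos j with rfl | hj
  · exact le_of_forcesMonoComponent_three h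
  · have : NeZero j := ⟨hj.ne'⟩
    simpa using (CyclicConstruction.latinSquare j).le_of_forcesMonoComponent
      (m := m) (by simpa using h)

theorem le_monoComponentNumber {n m : ℕ} (h : ForcesMonoComponent n m) :
    (m : ℕ∞) ≤ monoComponentNumber n :=
  le_sSup ⟨m, h, rfl⟩

theorem theorem1 :
    (∀ k : ℕ, ((4 * k + 3 : ℕ) : ℕ∞) ≤ monoComponentNumber (6 * k + 3)) ∧
    (∀ k : ℕ, 3 ∣ k → monoComponentNumber (6 * k + 3) = ((4 * k + 3 : ℕ) : ℕ∞)) ∧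
    (∀ k : ℕ, 1 ≤ k → ((4 * k + 2 : ℕ) : ℕ∞) ≤ monoComponentNumber (6 * k + 1)) := by
  refine ⟨fun k => le_monoComponentNumber (forcesMonoComponent_three_mod_six k), ?_,
    fun k hk => le_monoComponentNumber (forcesMonoComponent_one_mod_six hk)⟩
  rintro k ⟨j, rfl⟩
  refine le_antisymm (sSup_le ?_)
    (le_monoComponentNumber (forcesMonoComponent_three_mod_six _))
  rintro _ ⟨m, hm, rfl⟩
  have h18 : 6 * (3 * j) + 3 = 18 * j + 3 := by ring
  have := le_of_forcesMonoComponent_eighteen_mul_add_three j (h18 ▸ hm)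
  exact Nat.cast_le.2 (by omega)
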